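/- Let $0<\alpha\le 1$ and let $f:[0,1]\to(0,\infty)$ be $\alpha$-Lipschitzian, i.e. $|f(x)-f(y)|\le L|x-y|^\alpha$ for some constant $L$ and all $x,y\in[0,1]$. Put $D=\{(x,y)\in\mathbb R^2: 0\le x\le 1,\ 0\le y\le f(x)\}$, let $\lambda$ be Lebesgue measure on $\mathbb R^2$ and $c=1/\lambda(D)$. Let $K$ be a bounded probability density on $\mathbb R$ with support in a compact interval $[-A,A]$, piecewise $C^2$ with bounded first derivative. Let $(k_n)$ be a nondecreasing sequence of integers with $k_n\to\infty$ and $0<k_n<n$ for all large $n$, and let $(h_n)$ be a nonincreasing sequence of positive numbers with $h_n\to 0$. For a finite set $S\subset\mathbb R^2$ and $1\le r\le k_n$ let $U_{n,r}(S)=\max\{y:(x,y)\in S,\ x\in[(r-1)/k_n,\,r/k_n)\}$, with $\max\varnothing=0$, let $x_r=(r-\tfrac12)/k_n$, and define $$\hat f_n(x;S)=\frac1{k_n}\sum_{r=1}^{k_n}\frac1{h_n}K\!\left(\frac{x-x_r}{h_n}\right)\left(U_{n,r}(S)+\frac1{n-k_n}\sum_{s=1}^{k_n}U_{n,s}(S)\right).$$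 Let $Z_1,Z_2,\dots$ be independent random points uniformly distributed on $D$ and, for each $n$, let $N_{0,n}$ be a Poisson random variable with mean $n$ that is independent of the sequence $(Z_i)_{i\ge1}$. Put $\Sigma_n=\{Z_1,\dots,Z_n\}$ and $\Sigma_{0,n}=\{Z_1,\dots,Z_{N_{0,n}}\}$ (the latter is a Poisson point process with mean measure $nc\,\lambda\,1_D$), and let $\hat f_n(x)=\hat f_n(x;\Sigma_n)$ and $\hat f_{0,n}(x)=\hat f_n(x;\Sigma_{0,n})$. If $k_n=o(n/\log n)$, $h_nk_n\to\infty$ and $n=O(k_n^{1+\alpha})$, then for every $x\in(0,1)$ the difference $\hat f_n(x)-\hat f_{0,n}(x)$ is integrable and $$\frac{n h_n^{1/2}}{k_n^{1/2}}\;\mathbb E\left|\hat f_n(x)-\hat f_{0,n}(x)\right|\longrightarrow 0\qquad(n\to\infty).$$ -/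

import Mathlib

open MeasureTheory ProbabilityTheory Filter Topology Asymptotics
open scoped NNReal

noncomputable section

namespace BoundaryEstimation

/-- The planar set `D = {(x, y) : 0 ≤ x ≤ 1, 0 ≤ y ≤ f x}` lying below the graph of `f`. -/
def region (f : ℝ → ℝ) : Set (ℝ × ℝ) :=
  {p | p.1 ∈ Set.Icc (0 : ℝ) 1 ∧ 0 ≤ p.2 ∧ p.2 ≤ f p.1}

/-- The random set consisting of the first `m` points of the sequence `Z`
(which is indexed from `0`). -/
def firstPoints {Ω : Type*} (Z : ℕ → Ω → ℝ × ℝ) (m : ℕ) (ω : Ω) : Set (ℝ × ℝ) :=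
  {p | ∃ i < m, Z i ω = p}

/-- The cell `[(r - 1) / k, r / k)`, for `r = 1, …, k`. -/
def cell (k r : ℕ) : Set ℝ := Set.Ico (((r : ℝ) - 1) / k) ((r : ℝ) / k)

/-- The center of `cell k r`. -/
def cellCenter (k r : ℕ) : ℝ := ((r : ℝ) - 1 / 2) / k

/-- The largest ordinate of the points of `S` whose abscissa lies in `cell k r`.
It is applied to finite sets `S`, for which the supremum is a maximum; if no point of `S`
has its abscissa in the cell, the value is `sSup ∅ = 0`. -/
def cellMax (S : Set (ℝ × ℝ)) (k r : ℕ) : ℝ :=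
  sSup {y | ∃ p ∈ S, p.1 ∈ cell k r ∧ p.2 = y}

/-- The rescaled kernel `t ↦ K (t / h) / h`. -/
def scaledKernel (K : ℝ → ℝ) (h t : ℝ) : ℝ := 1 / h * K (t / h)

/-- The kernel estimator at `x` of the upper edge, with parameters `n`, `k`, `h`, computed from
the set of points `S`. -/
def estimator (K : ℝ → ℝ) (n k : ℕ) (h : ℝ) (S : Set (ℝ × ℝ)) (x : ℝ) : ℝ :=
  1 / (k : ℝ) * ∑ r ∈ Finset.Icc 1 k, scaledKernel K h (x - cellCenter k r) *
    (cellMax S k r + 1 / ((n : ℝ) - k) * ∑ s ∈ Finset.Icc 1 k, cellMax S k s)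

/-- `K` is a bounded probability density supported in a compact interval `[-A, A]`, piecewise
`C²` with bounded first derivative. Nothing is required at the finitely many break points, so
this covers in particular every such `K` that is differentiable on the whole line. -/
structure IsKernel (K : ℝ → ℝ) : Prop where
  nonneg : ∀ t, 0 ≤ K t
  integral_eq_one : ∫ t, K t = 1
  bounded : ∃ B, ∀ t, K t ≤ B
  support_subset : ∃ A, Function.support K ⊆ Set.Icc (-A) A
  piecewise : ∃ T : Set ℝ, T.Finite ∧ ContDiffOn ℝ 2 K Tᶜ ∧ ∃ C, ∀ t ∉ T, |deriv K t| ≤ C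

end BoundaryEstimation

end

/-! Both estimators are the same linear functional of the cell maxima, whose coefficients have
bounded `ℓ¹`-norm, so it suffices to bound, for each cell, the expected difference of its maxima
over `Z₁, …, Zₙ` and over `Z₁, …, Z_N`, with `N` independent of the points. If `N ≥ n / 2`, these
maxima differ by at most the sum of the amounts by which the `|N - n|` points between the two times
exceed the maximum of the first `n / 2` points. With `Y` the height of a point over the cell, each
excess has expectation `∫ P(Y ≤ y)^(n/2) P(Y > y) dy` by the layer cake formula. This is
`O(k / n²)`: the tail of `Y` is linear of slope `1 / (λ(D) k)` below the minimum of `f` on the cell,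
and `f` oscillates there by `O(k⁻ᵅ) = O(k / n)`. As `E|N - n| ≤ √n` and `P(N < n / 2) ≤ 4 / n`, the
difference of the maxima is `O(√k / n)`, and the normalization leaves `O(√h)`. -/
open scoped ENNReal

namespace BoundaryEstimation

section Poisson

theorem hasSum_poisson_mul_natCast_mul {r s : ℝ} {g : ℕ → ℝ}
    (hg : HasSum (fun n : ℕ => Real.exp (-r) * r ^ n / n.factorial * g (n + 1)) s) :
    HasSum (fun n : ℕ => Real.exp (-r) * r ^ n / n.factorial * (n * g n)) (r * s) := by
  rw [← hasSum_nat_add_iff' 1]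
  simp only [Finset.range_one, Finset.sum_singleton, Nat.cast_zero, zero_mul, mul_zero, sub_zero]
  refine (hg.mul_left r).congr_fun fun n => ?_
  have : (n : ℝ) + 1 ≠ 0 := by positivity
  rw [Nat.factorial_succ]
  push_cast
  field_simp
  ring

theorem hasSum_poisson_mul_natCast_sub_sq (r : ℝ≥0) :
    HasSum (fun n : ℕ => Real.exp (-r) * r ^ n / n.factorial * ((n : ℝ) - r) ^ 2) r := by
  have mass := hasSum_one_poissonMeasure r
  have mean : HasSum (fun n : ℕ => Real.exp (-r) * r ^ n / n.factorial * (n : ℝ)) r := by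
    simpa using hasSum_poisson_mul_natCast_mul (s := 1) (g := 1) (by simpa using mass)
  have secondMoment : HasSum (fun n : ℕ => Real.exp (-r) * r ^ n / n.factorial * (n * (n : ℝ)))
      (r * (r + 1)) :=
    hasSum_poisson_mul_natCast_mul (s := r + 1) (by simpa [mul_add] using mean.add mass)
  have h := (secondMoment.sub (mean.mul_left (2 * (r : ℝ)))).add (mass.mul_left ((r : ℝ) ^ 2))
  rw [show (r : ℝ) * (r + 1) - 2 * r * r + r ^ 2 * 1 = r by ring] at h
  exact h.congr_fun fun n => by ring

theorem eLpNorm_natCast_sub_poissonMeasure (r : ℝ≥0) :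
    eLpNorm (fun n : ℕ => (n : ℝ) - r) 2 (poissonMeasure r) = ENNReal.ofReal √r := by
  have hvar := hasSum_poisson_mul_natCast_sub_sq r
  have hint : Integrable (fun n : ℕ => ((n : ℝ) - r) ^ 2) (poissonMeasure r) := by
    rw [integrable_poissonMeasure_iff]
    exact hvar.summable.congr fun n => by rw [Real.norm_of_nonneg (sq_nonneg _)]
  have hmem : MemLp (fun n : ℕ => (n : ℝ) - r) 2 (poissonMeasure r) :=
    (memLp_two_iff_integrable_sq (by fun_prop)).2 hint
  rw [hmem.eLpNorm_eq_integral_rpow_norm two_ne_zero ENNReal.ofNat_ne_top]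
  simp only [ENNReal.toReal_ofNat, Real.rpow_two, Real.norm_eq_abs, sq_abs]
  rw [integral_poissonMeasure]
  simp only [smul_eq_mul, hvar.tsum_eq, Real.sqrt_eq_rpow, one_div]

theorem eLpNorm_natCast_sub_of_hasLaw_poissonMeasure {Ω : Type*} [MeasurableSpace Ω]
    {P : Measure Ω} {N : Ω → ℕ} {r : ℝ≥0} (hN : HasLaw N (poissonMeasure r) P) :
    eLpNorm (fun ω => (N ω : ℝ) - r) 2 P = ENNReal.ofReal √r := by
  rw [← eLpNorm_natCast_sub_poissonMeasure, ← hN.map_eq]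
  exact (eLpNorm_map_measure (f := N) (g := fun n : ℕ => (n : ℝ) - r)
    (Measurable.of_discrete).aestronglyMeasurable hN.aemeasurable).symm

end Poisson

section Extremes

theorem edist_sup_range_le_sum (v : ℕ → ℝ≥0) {l m n : ℕ} (hm : l ≤ m) (hn : l ≤ n) :
    edist ((Finset.range m).sup v) ((Finset.range n).sup v) ≤
      ∑ i ∈ Finset.Ico (min m n) (max m n), ((v i - (Finset.range l).sup v : ℝ≥0) : ℝ≥0∞) := by
  wlog hmn : m ≤ n generalizing m n
  · simpa only [edist_comm, min_comm, max_comm] using this hn hm (le_of_not_ge hmn)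
  have hmono : ∀ {i j : ℕ}, i ≤ j → (Finset.range i).sup v ≤ (Finset.range j).sup v :=
    fun h => Finset.sup_mono (Finset.range_subset_range.2 h)
  have hincr : (Finset.range n).sup v ≤ (Finset.range m).sup v +
      ∑ i ∈ Finset.Ico m n, (v i - (Finset.range l).sup v) := by
    refine Finset.sup_le fun i hi => ?_
    rcases lt_or_ge i m with him | hmi
    · exact (Finset.le_sup (Finset.mem_range.2 him)).trans le_self_add
    · have hterm := Finset.single_le_sum (f := fun i => v i - (Finset.range l).sup v)
        (fun _ _ => zero_le) (Finset.mem_Ico.2 ⟨hmi, Finset.mem_range.1 hi⟩)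
      exact le_add_tsub.trans (add_le_add (hmono hm) hterm)
  rw [min_eq_left hmn, max_eq_right hmn, edist_nndist, NNReal.nndist_eq,
    tsub_eq_zero_of_le (hmono hmn), max_eq_right zero_le]
  exact_mod_cast tsub_le_iff_left.2 hincr

variable {Ω : Type*} [MeasurableSpace Ω] {P : Measure Ω}

theorem measurable_sup_range {v : ℕ → Ω → ℝ≥0} (hv : ∀ i, Measurable (v i)) (m : ℕ) :
    Measurable fun ω => (Finset.range m).sup fun i => v i ω := by
  induction m with
  | zero => simp
  | succ m ih =>
    simp only [Finset.range_add_one, Finset.sup_insert]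
    exact (hv m).sup ih

theorem lintegral_edist_sup_range_le {v : ℕ → Ω → ℝ≥0} (hv : ∀ i, Measurable (v i)) {l m n : ℕ}
    (hm : l ≤ m) (hn : l ≤ n) {ε : ℝ≥0∞}
    (hε : ∀ i, l ≤ i →
      ∫⁻ ω, ((v i ω - (Finset.range l).sup fun j => v j ω : ℝ≥0) : ℝ≥0∞) ∂P ≤ ε) :
    ∫⁻ ω, edist ((Finset.range m).sup fun j => v j ω) ((Finset.range n).sup fun j => v j ω) ∂P ≤
      ‖(m : ℝ) - n‖ₑ * ε := by
  have hcard : ((max m n - min m n : ℕ) : ℝ≥0∞) = ‖(m : ℝ) - n‖ₑ := by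
    rw [← ofReal_norm, Real.norm_eq_abs, ← max_sub_min_eq_abs', ← Nat.cast_max,
      ← Nat.cast_min, ← Nat.cast_sub (min_le_max), ENNReal.ofReal_natCast]
  calc ∫⁻ ω, edist ((Finset.range m).sup fun j => v j ω) ((Finset.range n).sup fun j => v j ω) ∂P
      ≤ ∫⁻ ω, ∑ i ∈ Finset.Ico (min m n) (max m n),
          ((v i ω - (Finset.range l).sup fun j => v j ω : ℝ≥0) : ℝ≥0∞) ∂P :=
        lintegral_mono fun ω => edist_sup_range_le_sum (fun j => v j ω) hm hn
    _ = ∑ i ∈ Finset.Ico (min m n) (max m n),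
          ∫⁻ ω, ((v i ω - (Finset.range l).sup fun j => v j ω : ℝ≥0) : ℝ≥0∞) ∂P :=
        lintegral_finsetSum _ fun i _ =>
          ((hv i).sub (measurable_sup_range hv l)).coe_nnreal_ennreal
    _ ≤ ∑ _ ∈ Finset.Ico (min m n) (max m n), ε :=
        Finset.sum_le_sum fun i hi => hε i ((le_min hm hn).trans (Finset.mem_Ico.1 hi).1)
    _ = ‖(m : ℝ) - n‖ₑ * ε := by
        rw [Finset.sum_const, Nat.card_Ico, nsmul_eq_mul, hcard]

theorem lintegral_comp_of_indepFun [IsFiniteMeasure P] {β γ : Type*} [MeasurableSpace β]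
    [MeasurableSpace γ] {X : Ω → β} {Y : Ω → γ} (hX : Measurable X) (hY : Measurable Y)
    (hXY : IndepFun X Y P) {g : β × γ → ℝ≥0∞} (hg : Measurable g) :
    ∫⁻ ω, g (X ω, Y ω) ∂P = ∫⁻ ω, ∫⁻ ω', g (X ω, Y ω') ∂P ∂P := by
  rw [← lintegral_map hg (hX.prodMk hY),
    (indepFun_iff_map_prod_eq_prod_map_map hX.aemeasurable hY.aemeasurable).1 hXY,
    lintegral_prod _ hg.aemeasurable, lintegral_map hg.lintegral_prod_right' hX]
  exact lintegral_congr fun ω => lintegral_map (hg.comp measurable_prodMk_left) hY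

theorem lintegral_edist_sup_range_random_le [IsProbabilityMeasure P] {v : ℕ → Ω → ℝ≥0}
    (hv : ∀ i, Measurable (v i)) {F : ℝ≥0} (hvF : ∀ᵐ ω ∂P, ∀ i, v i ω ≤ F) {N : Ω → ℕ}
    (hN : Measurable N) (hNv : IndepFun N (fun ω i => v i ω) P) {l n : ℕ} (hn : l ≤ n) {ε : ℝ≥0∞}
    (hε : ∀ i, l ≤ i →
      ∫⁻ ω, ((v i ω - (Finset.range l).sup fun j => v j ω : ℝ≥0) : ℝ≥0∞) ∂P ≤ ε) :
    ∫⁻ ω, edist ((Finset.range n).sup fun j => v j ω)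
        ((Finset.range (N ω)).sup fun j => v j ω) ∂P ≤
      eLpNorm (fun ω => (N ω : ℝ) - n) 1 P * ε + P {ω | N ω < l} * F := by
  have hmeas : Measurable fun p : ℕ × (ℕ → ℝ≥0) =>
      edist ((Finset.range n).sup p.2) ((Finset.range p.1).sup p.2) :=
    measurable_from_prod_countable_right fun m =>
      (measurable_sup_range measurable_pi_apply n).edist
        (measurable_sup_range measurable_pi_apply m)
  have hlt : MeasurableSet {ω | N ω < l} := measurableSet_lt hN measurable_const
  have hfixed : ∀ m, ∫⁻ ω, edist ((Finset.range n).sup fun j => v j ω)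
      ((Finset.range m).sup fun j => v j ω) ∂P ≤
        ‖(m : ℝ) - n‖ₑ * ε + {m | m < l}.indicator (fun _ => (F : ℝ≥0∞)) m := by
    intro m
    rcases lt_or_ge m l with hml | hlm
    · have hbdd : ∀ᵐ ω ∂P, edist ((Finset.range n).sup fun j => v j ω)
          ((Finset.range m).sup fun j => v j ω) ≤ F := by
        filter_upwards [hvF] with ω hω
        have hsup : ∀ m, (Finset.range m).sup (fun j => v j ω) ≤ F :=
          fun m => Finset.sup_le fun i _ => hω i
        rw [edist_nndist, NNReal.nndist_eq]
        exact_mod_cast max_le (tsub_le_self.trans (hsup n)) (tsub_le_self.trans (hsup m))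
      rw [Set.indicator_of_mem (show m ∈ {m | m < l} from hml)]
      exact ((lintegral_mono_ae hbdd).trans_eq (by simp)).trans le_add_self
    · simp only [edist_comm ((Finset.range n).sup _)]
      exact (lintegral_edist_sup_range_le hv hlm hn hε).trans le_self_add
  calc ∫⁻ ω, edist ((Finset.range n).sup fun j => v j ω)
        ((Finset.range (N ω)).sup fun j => v j ω) ∂P
      = ∫⁻ ω, ∫⁻ ω', edist ((Finset.range n).sup fun j => v j ω')
          ((Finset.range (N ω)).sup fun j => v j ω') ∂P ∂P :=
        lintegral_comp_of_indepFun hN (measurable_pi_lambda _ hv) hNv hmeas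
    _ ≤ ∫⁻ ω, (‖(N ω : ℝ) - n‖ₑ * ε + {ω | N ω < l}.indicator (fun _ => (F : ℝ≥0∞)) ω) ∂P :=
        lintegral_mono fun ω => hfixed (N ω)
    _ = eLpNorm (fun ω => (N ω : ℝ) - n) 1 P * ε + P {ω | N ω < l} * F := by
        rw [lintegral_add_right _ (measurable_const.indicator hlt),
          lintegral_mul_const _ (by fun_prop), lintegral_indicator_const hlt,
          eLpNorm_one_eq_lintegral_enorm, mul_comm (F : ℝ≥0∞)]

theorem measure_lt_ceil_half_le {N : Ω → ℕ} (hN : Measurable N) {n : ℕ} (hn : 0 < n) :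
    P {ω | N ω < ⌈(n : ℝ) / 2⌉₊} ≤
      ENNReal.ofReal (4 / n ^ 2) * eLpNorm (fun ω => (N ω : ℝ) - n) 2 P ^ 2 := by
  have hpos : (0 : ℝ) < n / 2 := by positivity
  have hsub : {ω | N ω < ⌈(n : ℝ) / 2⌉₊} ⊆
      {ω | ENNReal.ofReal (n / 2) ≤ ‖(N ω : ℝ) - n‖ₑ} := by
    intro ω hω
    have hlt : (N ω : ℝ) < n / 2 := Nat.lt_ceil.1 hω
    rw [Set.mem_ofPred_eq, ← ofReal_norm]
    exact ENNReal.ofReal_le_ofReal ((by linarith : (n : ℝ) / 2 ≤ n - N ω).trans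
      ((le_abs_self _).trans_eq (abs_sub_comm _ _)))
  refine (measure_mono hsub).trans ((meas_ge_le_mul_pow_eLpNorm_enorm P two_ne_zero
    ENNReal.ofNat_ne_top (by fun_prop) (ENNReal.ofReal_pos.2 hpos).ne' (by simp)).trans_eq ?_)
  rw [ENNReal.toReal_ofNat, ENNReal.rpow_two, ENNReal.rpow_two, ← ENNReal.ofReal_inv_of_pos hpos,
    ← ENNReal.ofReal_pow (by positivity)]
  congr 2
  field_simp
  norm_num

theorem measure_lt_ceil_half_le_of_eLpNorm_le {N : Ω → ℕ} (hN : Measurable N) {n : ℕ} (hn : 0 < n)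
    {σ : ℝ≥0} (hσ : eLpNorm (fun ω => (N ω : ℝ) - n) 2 P ≤ ENNReal.ofReal (σ * √n)) :
    P {ω | N ω < ⌈(n : ℝ) / 2⌉₊} ≤ ENNReal.ofReal (4 * σ ^ 2 / n) := by
  calc P {ω | N ω < ⌈(n : ℝ) / 2⌉₊}
      ≤ ENNReal.ofReal (4 / n ^ 2) * ENNReal.ofReal (σ * √n) ^ 2 :=
        (measure_lt_ceil_half_le hN hn).trans (by gcongr)
    _ = ENNReal.ofReal (4 * σ ^ 2 / n) := by
        rw [← ENNReal.ofReal_pow (by positivity), ← ENNReal.ofReal_mul (by positivity), mul_pow,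
          Real.sq_sqrt (Nat.cast_nonneg n)]
        congr 1
        field_simp

theorem lintegral_ofReal_sub_eq_lintegral_measure [SFinite P] {X U : Ω → ℝ} (hX : Measurable X)
    (hU : Measurable U) :
    ∫⁻ ω, ENNReal.ofReal (X ω - U ω) ∂P = ∫⁻ y, P {ω | U ω ≤ y ∧ y < X ω} := by
  let S : Set (Ω × ℝ) := {p | U p.1 ≤ p.2 ∧ p.2 < X p.1}
  have hS : MeasurableSet S :=
    (measurableSet_le (hU.comp measurable_fst) measurable_snd).inter
      (measurableSet_lt measurable_snd (hX.comp measurable_fst))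
  calc ∫⁻ ω, ENNReal.ofReal (X ω - U ω) ∂P = ∫⁻ ω, volume (Prod.mk ω ⁻¹' S) ∂P :=
        lintegral_congr fun ω => Real.volume_Ico.symm
    _ = ∫⁻ y, P {ω | U ω ≤ y ∧ y < X ω} := by
        rw [← Measure.prod_apply hS, Measure.prod_apply_symm hS]
        rfl

theorem measure_sup_range_le_and_lt {v : ℕ → Ω → ℝ≥0} (hind : iIndepFun v P) {m i : ℕ}
    (hi : m ≤ i) (y : ℝ≥0) :
    P {ω | ((Finset.range m).sup fun j => v j ω) ≤ y ∧ y < v i ω} =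
      (∏ j ∈ Finset.range m, P {ω | v j ω ≤ y}) * P {ω | y < v i ω} := by
  let B : ℕ → Set ℝ≥0 := Function.update (fun _ => Set.Iic y) i (Set.Ioi y)
  have hBi : B i = Set.Ioi y := Function.update_self ..
  have hBj : ∀ j ∈ Finset.range m, B j = Set.Iic y := fun j hj =>
    Function.update_of_ne ((Finset.mem_range.1 hj).trans_le hi).ne _ _
  have hB : ∀ j, MeasurableSet (B j) := fun j => by
    rcases eq_or_ne j i with rfl | hj
    · simp only [hBi, measurableSet_Ioi]
    · simp only [B, Function.update_of_ne hj, measurableSet_Iic]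
  have hset : {ω | ((Finset.range m).sup fun j => v j ω) ≤ y ∧ y < v i ω} =
      ⋂ j ∈ insert i (Finset.range m), v j ⁻¹' B j := by
    ext ω
    rw [Finset.set_biInter_insert, Set.iInter₂_congr fun j hj => by rw [hBj j hj], hBi]
    simp [and_comm]
  rw [hset, hind.measure_inter_preimage_eq_mul _ fun j _ => hB j,
    Finset.prod_insert (by simpa using hi), mul_comm, hBi,
    Finset.prod_congr rfl fun j hj => by rw [hBj j hj]]
  rfl

theorem lintegral_sub_sup_range_le {v : ℕ → Ω → ℝ≥0} (hv : ∀ i, Measurable (v i))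
    (hind : iIndepFun v P) {G g : ℝ → ℝ≥0∞} (hG : ∀ i, ∀ y : ℝ≥0, P {ω | v i ω ≤ y} ≤ G y)
    (hg : ∀ i, ∀ y : ℝ≥0, P {ω | y < v i ω} ≤ g y) {m i : ℕ} (hi : m ≤ i) :
    ∫⁻ ω, ((v i ω - (Finset.range m).sup fun j => v j ω : ℝ≥0) : ℝ≥0∞) ∂P ≤
      ∫⁻ y in Set.Ici 0, G y ^ m * g y := by
  have := hind.isProbabilityMeasure
  set U : Ω → ℝ≥0 := fun ω => (Finset.range m).sup fun j => v j ω
  have hU : Measurable U := measurable_sup_range hv m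
  calc ∫⁻ ω, ((v i ω - U ω : ℝ≥0) : ℝ≥0∞) ∂P
      = ∫⁻ ω, ENNReal.ofReal ((v i ω : ℝ) - U ω) ∂P := by
        simp only [NNReal.sub_def, ENNReal.ofReal]
    _ = ∫⁻ y, P {ω | (U ω : ℝ) ≤ y ∧ y < v i ω} :=
        lintegral_ofReal_sub_eq_lintegral_measure (hv i).coe_nnreal_real hU.coe_nnreal_real
    _ ≤ ∫⁻ y, (Set.Ici 0).indicator (fun y => G y ^ m * g y) y := by
        refine lintegral_mono fun y => ?_
        rcases lt_or_ge y 0 with hy | hy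
        · have hempty : {ω | (U ω : ℝ) ≤ y ∧ y < v i ω} = ∅ :=
            Set.eq_empty_of_forall_notMem fun ω hω =>
              (hω.1.trans_lt hy).not_ge (U ω).coe_nonneg
          rw [hempty, measure_empty]
          exact zero_le
        · lift y to ℝ≥0 using hy
          rw [Set.indicator_of_mem (Set.mem_Ici.2 y.coe_nonneg)]
          norm_cast
          rw [measure_sup_range_le_and_lt hind hi]
          exact mul_le_mul' ((Finset.prod_le_pow_card _ _ _ fun j _ => hG j y).trans_eq
            (by rw [Finset.card_range])) (hg i y)
    _ = ∫⁻ y in Set.Ici 0, G y ^ m * g y := lintegral_indicator measurableSet_Ici _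

end Extremes

section ExponentialTail

theorem lintegral_pow_mul_exp_neg_mul_Ioi (s : ℕ) {b : ℝ} (hb : 0 < b) :
    ∫⁻ t in Set.Ioi 0, ENNReal.ofReal (t ^ s * Real.exp (-(b * t))) =
      ENNReal.ofReal (s.factorial / b ^ (s + 1)) := by
  have hval : ∫ t in Set.Ioi 0, t ^ s * Real.exp (-(b * t)) = s.factorial / b ^ (s + 1) := by
    have h := Real.integral_rpow_mul_exp_neg_mul_Ioi (a := s + 1) (by positivity) hb
    simp only [add_sub_cancel_right, Real.rpow_natCast, Real.Gamma_nat_eq_factorial] at h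
    rw [h, ← Nat.cast_add_one, Real.rpow_natCast, one_div, inv_pow, div_eq_inv_mul]
  have hint : IntegrableOn (fun t => t ^ s * Real.exp (-(b * t))) (Set.Ioi 0) :=
    .of_integral_ne_zero (by rw [hval]; positivity)
  rw [← hval, ofReal_integral_eq_lintegral_ofReal hint]
  filter_upwards [ae_restrict_mem measurableSet_Ioi] with t ht
  have ht : 0 < t := ht
  positivity

theorem lintegral_exp_neg_mul_mul_add_Ioi {b δ : ℝ} (hb : 0 < b) (hδ : 0 ≤ δ) :
    ∫⁻ t in Set.Ioi 0, ENNReal.ofReal (Real.exp (-(b * t)) * (t + δ)) =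
      ENNReal.ofReal (1 / b ^ 2 + δ / b) := by
  calc ∫⁻ t in Set.Ioi 0, ENNReal.ofReal (Real.exp (-(b * t)) * (t + δ))
      = ∫⁻ t in Set.Ioi 0, (ENNReal.ofReal (t ^ 1 * Real.exp (-(b * t))) +
          ENNReal.ofReal δ * ENNReal.ofReal (t ^ 0 * Real.exp (-(b * t)))) := by
        refine setLIntegral_congr_fun measurableSet_Ioi fun t (ht : 0 < t) => ?_
        rw [← ENNReal.ofReal_mul hδ, ← ENNReal.ofReal_add (by positivity) (by positivity)]
        congr 1
        ring
    _ = ENNReal.ofReal (1 / b ^ 2 + δ / b) := by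
        rw [lintegral_add_right _ (by fun_prop), lintegral_const_mul _ (by fun_prop),
          lintegral_pow_mul_exp_neg_mul_Ioi 1 hb, lintegral_pow_mul_exp_neg_mul_Ioi 0 hb,
          ← ENNReal.ofReal_mul hδ, ← ENNReal.ofReal_add (by positivity) (by positivity)]
        norm_num [div_eq_mul_inv]

theorem lintegral_add_Iic_le {δ : ℝ} (hδ : 0 ≤ δ) :
    ∫⁻ t in Set.Iic 0, ENNReal.ofReal (t + δ) ≤ ENNReal.ofReal (δ ^ 2) := by
  calc ∫⁻ t in Set.Iic 0, ENNReal.ofReal (t + δ)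
      ≤ ∫⁻ t, (Set.Icc (-δ) 0).indicator (fun _ => ENNReal.ofReal δ) t := by
        rw [← lintegral_indicator measurableSet_Iic]
        refine lintegral_mono fun t => Set.indicator_apply_le fun (ht : t ≤ 0) => ?_
        rcases lt_or_ge t (-δ) with htδ | htδ
        · exact (ENNReal.ofReal_of_nonpos (by linarith)).trans_le zero_le
        · rw [Set.indicator_of_mem (Set.mem_Icc.2 ⟨htδ, ht⟩)]
          exact ENNReal.ofReal_le_ofReal (by linarith)
    _ = ENNReal.ofReal (δ ^ 2) := by
        rw [lintegral_indicator_const measurableSet_Icc, Real.volume_Icc, ← ENNReal.ofReal_mul hδ]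
        congr 1
        ring

theorem lintegral_exp_neg_mul_max_mul_add_le {b δ : ℝ} (hb : 0 < b) (hδ : 0 ≤ δ) :
    ∫⁻ t, ENNReal.ofReal (Real.exp (-(b * max t 0)) * (t + δ)) ≤
      ENNReal.ofReal (1 / b ^ 2 + δ / b + δ ^ 2) := by
  rw [← lintegral_add_compl _ (measurableSet_Ioi (a := (0 : ℝ))), Set.compl_Ioi,
    ENNReal.ofReal_add (by positivity) (by positivity)]
  refine add_le_add ((setLIntegral_congr_fun measurableSet_Ioi fun t (ht : 0 < t) => ?_).trans
    (lintegral_exp_neg_mul_mul_add_Ioi hb hδ)).le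
    ((setLIntegral_congr_fun measurableSet_Iic fun t (ht : t ≤ 0) => ?_).trans_le
      (lintegral_add_Iic_le hδ))
  · rw [max_eq_left ht.le]
  · rw [max_eq_right ht, mul_zero, neg_zero, Real.exp_zero, one_mul]

theorem lintegral_exp_neg_mul_max_pow_mul_le {β δ : ℝ} (hβ : 0 < β) (hδ : 0 ≤ δ) (a : ℝ) {m : ℕ}
    (hm : 0 < m) :
    ∫⁻ y, ENNReal.ofReal (Real.exp (-(β * max (a - y) 0))) ^ m *
        ENNReal.ofReal (β * (a + δ - y)) ≤
      ENNReal.ofReal (1 / (m ^ 2 * β) + δ / m + β * δ ^ 2) := by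
  calc ∫⁻ y, ENNReal.ofReal (Real.exp (-(β * max (a - y) 0))) ^ m *
        ENNReal.ofReal (β * (a + δ - y))
      = ∫⁻ y, ENNReal.ofReal β *
          ENNReal.ofReal (Real.exp (-(m * β * max (a - y) 0)) * (a - y + δ)) := by
        refine lintegral_congr fun y => ?_
        rw [← ENNReal.ofReal_pow (Real.exp_nonneg _), ← ENNReal.ofReal_mul (by positivity),
          ← ENNReal.ofReal_mul hβ.le, ← Real.exp_nat_mul]
        congr 1
        ring_nf
    _ = ENNReal.ofReal β *
          ∫⁻ t, ENNReal.ofReal (Real.exp (-(m * β * max t 0)) * (t + δ)) := by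
        rw [lintegral_const_mul _ (by fun_prop), lintegral_sub_left_eq_self
          fun t => ENNReal.ofReal (Real.exp (-(m * β * max t 0)) * (t + δ))]
    _ ≤ ENNReal.ofReal β * ENNReal.ofReal (1 / (m * β) ^ 2 + δ / (m * β) + δ ^ 2) := by
        gcongr
        exact lintegral_exp_neg_mul_max_mul_add_le (by positivity) hδ
    _ = ENNReal.ofReal (1 / (m ^ 2 * β) + δ / m + β * δ ^ 2) := by
        rw [← ENNReal.ofReal_mul hβ.le]
        congr 1
        field_simp

end ExponentialTail

section Geometry

variable {f : ℝ → ℝ} {C : Set ℝ}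

theorem measurableSet_region (hf : ContinuousOn f (Set.Icc 0 1)) : MeasurableSet (region f) := by
  have hstrip : IsClosed (Set.Icc (0 : ℝ) 1 ×ˢ Set.Ici (0 : ℝ)) := isClosed_Icc.prod isClosed_Ici
  have hgap : ContinuousOn (fun p : ℝ × ℝ => f p.1 - p.2) (Set.Icc 0 1 ×ˢ Set.Ici 0) :=
    (hf.comp continuousOn_fst fun p hp => hp.1).sub continuousOn_snd
  convert (hgap.preimage_isClosed_of_isClosed hstrip (isClosed_Ici (a := (0 : ℝ)))).measurableSet
    using 1
  ext p
  simp [region, and_assoc]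

theorem cell_subset_Icc {k r : ℕ} (hr : r ∈ Finset.Icc 1 k) : cell k r ⊆ Set.Icc 0 1 := by
  obtain ⟨hr1, hrk⟩ := Finset.mem_Icc.1 hr
  have hr1 : (1 : ℝ) ≤ r := by exact_mod_cast hr1
  have hrk : (r : ℝ) ≤ k := by exact_mod_cast hrk
  have hleft : 0 ≤ ((r : ℝ) - 1) / k := div_nonneg (by linarith) (by positivity)
  have hright : (r : ℝ) / k ≤ 1 := div_le_one_of_le₀ hrk (by positivity)
  exact fun x hx => ⟨hleft.trans hx.1, hx.2.le.trans hright⟩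

theorem cellCenter_mem_cell {k : ℕ} (hk : 0 < k) (r : ℕ) : cellCenter k r ∈ cell k r := by
  constructor <;> unfold cellCenter <;> gcongr <;> linarith

theorem abs_sub_le_of_mem_cell {k r : ℕ} {x y : ℝ} (hx : x ∈ cell k r) (hy : y ∈ cell k r) :
    |x - y| ≤ 1 / k := by
  have hwidth : (r : ℝ) / k - ((r : ℝ) - 1) / k = 1 / k := by ring
  rw [abs_le]
  constructor <;> linarith [hx.1, hx.2, hy.1, hy.2]

theorem measurableSet_cell (k r : ℕ) : MeasurableSet (cell k r) :=
  measurableSet_Ico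

theorem volume_cell (k r : ℕ) : volume (cell k r) = ENNReal.ofReal (1 / k) := by
  rw [cell, Real.volume_Ico]
  ring_nf

/-- The ordinate of a point of the upper half-plane whose abscissa lies in `C`, and `0` for the
other points. With values in `ℝ≥0`, the largest ordinate over `C` of finitely many points is the
`Finset.sup` of their heights, an empty supremum being `0`. -/
noncomputable def heightOver (C : Set ℝ) : ℝ × ℝ → ℝ≥0 :=
  (Prod.fst ⁻¹' C).indicator fun p => p.2.toNNReal

theorem heightOver_of_mem {p : ℝ × ℝ} (hp : p.1 ∈ C) : heightOver C p = p.2.toNNReal :=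
  Set.indicator_of_mem (s := Prod.fst ⁻¹' C) hp _

theorem heightOver_of_notMem {p : ℝ × ℝ} (hp : p.1 ∉ C) : heightOver C p = 0 :=
  Set.indicator_of_notMem (s := Prod.fst ⁻¹' C) hp _

theorem measurable_heightOver (hC : MeasurableSet C) : Measurable (heightOver C) :=
  measurable_snd.real_toNNReal.indicator (measurable_fst hC)

theorem lt_heightOver_iff {y : ℝ≥0} {p : ℝ × ℝ} :
    y < heightOver C p ↔ p ∈ C ×ˢ Set.Ioi (y : ℝ) := by
  by_cases hp : p.1 ∈ C
  · simp [heightOver_of_mem hp, hp, Real.lt_toNNReal_iff_coe_lt]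
  · simp [heightOver_of_notMem hp, hp]

theorem heightOver_le_of_mem_region {F : ℝ≥0} (hF : ∀ x ∈ Set.Icc (0 : ℝ) 1, f x ≤ F)
    {p : ℝ × ℝ} (hp : p ∈ region f) : heightOver C p ≤ F :=
  Set.indicator_le' (fun _ _ => Real.toNNReal_le_iff_le_coe.2 (hp.2.2.trans (hF _ hp.1)))
    (fun _ _ => zero_le) p

theorem cellMax_firstPoints {Ω : Type*} {Z : ℕ → Ω → ℝ × ℝ} {ω : Ω}
    (hω : ∀ i, 0 ≤ (Z i ω).2) (m k r : ℕ) :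
    cellMax (firstPoints Z m ω) k r =
      ((Finset.range m).sup fun i => heightOver (cell k r) (Z i ω) : ℝ≥0) := by
  set S : Set ℝ := {y | ∃ p ∈ firstPoints Z m ω, p.1 ∈ cell k r ∧ p.2 = y}
  have hval : ∀ i, (Z i ω).1 ∈ cell k r → (heightOver (cell k r) (Z i ω) : ℝ) = (Z i ω).2 :=
    fun i hi => by rw [heightOver_of_mem hi, Real.coe_toNNReal _ (hω i)]
  have hle : ∀ y ∈ S, y ≤ ((Finset.range m).sup fun i => heightOver (cell k r) (Z i ω) : ℝ≥0) := by
    rintro _ ⟨_, ⟨i, hi, rfl⟩, hcell, rfl⟩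
    rw [← hval i hcell, NNReal.coe_le_coe]
    exact Finset.le_sup (f := fun i => heightOver (cell k r) (Z i ω)) (Finset.mem_range.2 hi)
  have hS : 0 ≤ sSup S := Real.sSup_nonneg fun y ⟨_, ⟨i, _, hp⟩, _, hy⟩ => hy ▸ hp ▸ hω i
  refine le_antisymm (Real.sSup_le hle NNReal.zero_le_coe) ?_
  lift sSup S to ℝ≥0 using hS with s hs
  rw [cellMax, ← hs, NNReal.coe_le_coe]
  refine Finset.sup_le fun i hi => ?_
  by_cases hcell : (Z i ω).1 ∈ cell k r
  · rw [← NNReal.coe_le_coe, hval i hcell, hs]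
    exact le_csSup ⟨_, hle⟩ ⟨_, ⟨i, Finset.mem_range.1 hi, rfl⟩, hcell, rfl⟩
  · rw [heightOver_of_notMem hcell]
    exact zero_le

theorem enorm_cellMax_firstPoints_sub {Ω : Type*} {Z : ℕ → Ω → ℝ × ℝ} {ω : Ω}
    (hω : ∀ i, 0 ≤ (Z i ω).2) (m n k r : ℕ) :
    ‖cellMax (firstPoints Z m ω) k r - cellMax (firstPoints Z n ω) k r‖ₑ =
      edist ((Finset.range m).sup fun i => heightOver (cell k r) (Z i ω))
        ((Finset.range n).sup fun i => heightOver (cell k r) (Z i ω)) := by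
  rw [cellMax_firstPoints hω, cellMax_firstPoints hω, ← edist_eq_enorm_sub]
  rfl

end Geometry

section Uniform

variable {Ω : Type*} [MeasurableSpace Ω] {P : Measure Ω} {f : ℝ → ℝ} {C : Set ℝ}

theorem volume_ne_zero_and_ne_top_of_isUniform [IsProbabilityMeasure P] {X : Ω → ℝ × ℝ}
    (hX : Measurable X) {s : Set (ℝ × ℝ)} (hu : pdf.IsUniform X s P volume) :
    volume s ≠ 0 ∧ volume s ≠ ⊤ := by
  have hmass : P.map X Set.univ = 1 := by
    rw [Measure.map_apply hX .univ, Set.preimage_univ, measure_univ]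
  rw [hu, cond_apply' .univ, Set.inter_univ] at hmass
  constructor <;> intro h <;> simp [h] at hmass

theorem measure_lt_heightOver [IsProbabilityMeasure P] {X : Ω → ℝ × ℝ} (hX : Measurable X)
    (hu : pdf.IsUniform X (region f) P volume) (hC : MeasurableSet C) (y : ℝ≥0) :
    P {ω | y < heightOver C (X ω)} =
      volume (region f ∩ C ×ˢ Set.Ioi (y : ℝ)) / volume (region f) := by
  obtain ⟨h0, ht⟩ := volume_ne_zero_and_ne_top_of_isUniform hX hu
  simp only [lt_heightOver_iff]
  exact hu.measure_preimage h0 ht (hC.prod measurableSet_Ioi)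

theorem volume_prod_Ioc_div (hC : C ⊆ Set.Icc 0 1) {s : Set (ℝ × ℝ)} (h0 : volume s ≠ 0)
    (ht : volume s ≠ ⊤) (y b : ℝ) :
    volume (C ×ˢ Set.Ioc y b) / volume s =
      ENNReal.ofReal (volume.real C / volume.real s * (b - y)) := by
  have hCtop : volume C ≠ ⊤ := measure_ne_top_of_subset hC measure_Icc_lt_top.ne
  rw [ENNReal.ofReal_mul (by positivity),
    ENNReal.ofReal_div_of_pos (y := volume.real s) (ENNReal.toReal_pos h0 ht),
    ofReal_measureReal hCtop, ofReal_measureReal ht, Measure.volume_eq_prod, Measure.prod_prod,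
    Real.volume_Ioc, ENNReal.mul_div_right_comm]

theorem measure_lt_heightOver_le [IsProbabilityMeasure P] {X : Ω → ℝ × ℝ} (hX : Measurable X)
    (hu : pdf.IsUniform X (region f) P volume) (hC : MeasurableSet C) (hC1 : C ⊆ Set.Icc 0 1)
    {b : ℝ} (hb : ∀ x ∈ C, f x ≤ b) (y : ℝ≥0) :
    P {ω | y < heightOver C (X ω)} ≤
      ENNReal.ofReal (volume.real C / volume.real (region f) * (b - y)) := by
  obtain ⟨h0, ht⟩ := volume_ne_zero_and_ne_top_of_isUniform hX hu
  rw [measure_lt_heightOver hX hu hC, ← volume_prod_Ioc_div hC1 h0 ht]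
  gcongr
  exact fun p ⟨hp, hpC, hpy⟩ => ⟨hpC, hpy, hp.2.2.trans (hb _ hpC)⟩

theorem le_measure_lt_heightOver [IsProbabilityMeasure P] {X : Ω → ℝ × ℝ} (hX : Measurable X)
    (hu : pdf.IsUniform X (region f) P volume) (hC : MeasurableSet C) (hC1 : C ⊆ Set.Icc 0 1)
    {a : ℝ} (ha : ∀ x ∈ C, a ≤ f x) (y : ℝ≥0) :
    ENNReal.ofReal (volume.real C / volume.real (region f) * (a - y)) ≤
      P {ω | y < heightOver C (X ω)} := by
  obtain ⟨h0, ht⟩ := volume_ne_zero_and_ne_top_of_isUniform hX hu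
  rw [measure_lt_heightOver hX hu hC, ← volume_prod_Ioc_div hC1 h0 ht]
  gcongr
  exact fun p ⟨hpC, hpy, hpa⟩ => ⟨⟨hC1 hpC, y.coe_nonneg.trans hpy.le, hpa.trans (ha _ hpC)⟩,
    hpC, hpy⟩

theorem measure_heightOver_le_le [IsProbabilityMeasure P] {X : Ω → ℝ × ℝ} (hX : Measurable X)
    (hu : pdf.IsUniform X (region f) P volume) (hC : MeasurableSet C) (hC1 : C ⊆ Set.Icc 0 1)
    {a : ℝ} (ha : ∀ x ∈ C, a ≤ f x) (y : ℝ≥0) :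
    P {ω | heightOver C (X ω) ≤ y} ≤ ENNReal.ofReal
      (Real.exp (-(volume.real C / volume.real (region f) * max (a - y) 0))) := by
  set β := volume.real C / volume.real (region f)
  have hβ : 0 ≤ β := by positivity
  have hmeas : MeasurableSet {ω | y < heightOver C (X ω)} :=
    measurableSet_lt measurable_const ((measurable_heightOver hC).comp hX)
  have hcompl : {ω | heightOver C (X ω) ≤ y} = {ω | y < heightOver C (X ω)}ᶜ := by
    ext ω
    simp
  calc P {ω | heightOver C (X ω) ≤ y}
      = 1 - P {ω | y < heightOver C (X ω)} := by rw [hcompl, prob_compl_eq_one_sub hmeas]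
    _ ≤ 1 - ENNReal.ofReal (β * max (a - y) 0) := by
        refine tsub_le_tsub_left ?_ _
        rw [mul_max_of_nonneg _ _ hβ, mul_zero, ENNReal.ofReal_max, ENNReal.ofReal_zero,
          max_eq_left zero_le]
        exact le_measure_lt_heightOver hX hu hC hC1 ha y
    _ = ENNReal.ofReal (1 - β * max (a - y) 0) := by
        rw [← ENNReal.ofReal_one, ENNReal.ofReal_sub _ (by positivity)]
    _ ≤ ENNReal.ofReal (Real.exp (-(β * max (a - y) 0))) :=
        ENNReal.ofReal_le_ofReal (Real.one_sub_le_exp_neg _)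

theorem lintegral_heightOver_sub_sup_range_le {Z : ℕ → Ω → ℝ × ℝ} (hZ : ∀ i, Measurable (Z i))
    (hind : iIndepFun Z P) (hu : ∀ i, pdf.IsUniform (Z i) (region f) P volume)
    (hC : MeasurableSet C) (hC1 : C ⊆ Set.Icc 0 1) (hC0 : volume C ≠ 0) {a δ : ℝ} (hδ : 0 ≤ δ)
    (ha : ∀ x ∈ C, a ≤ f x) (hb : ∀ x ∈ C, f x ≤ a + δ) {m i : ℕ} (hm : 0 < m) (hi : m ≤ i) :
    ∫⁻ ω, ((heightOver C (Z i ω) -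
        (Finset.range m).sup fun j => heightOver C (Z j ω) : ℝ≥0) : ℝ≥0∞) ∂P ≤
      ENNReal.ofReal (1 / (m ^ 2 * (volume.real C / volume.real (region f))) + δ / m +
        volume.real C / volume.real (region f) * δ ^ 2) := by
  have := hind.isProbabilityMeasure
  obtain ⟨h0, ht⟩ := volume_ne_zero_and_ne_top_of_isUniform (hZ 0) (hu 0)
  set β := volume.real C / volume.real (region f)
  have hβ : 0 < β :=
    div_pos (ENNReal.toReal_pos hC0 (measure_ne_top_of_subset hC1 measure_Icc_lt_top.ne))
      (ENNReal.toReal_pos h0 ht)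
  refine (lintegral_sub_sup_range_le (v := fun i ω => heightOver C (Z i ω))
    (G := fun y => ENNReal.ofReal (Real.exp (-(β * max (a - y) 0))))
    (g := fun y => ENNReal.ofReal (β * (a + δ - y)))
    (fun i => (measurable_heightOver hC).comp (hZ i))
    (hind.comp (fun _ => heightOver C) fun _ => measurable_heightOver hC)
    (fun i => measure_heightOver_le_le (hZ i) (hu i) hC hC1 ha)
    (fun i => measure_lt_heightOver_le (hZ i) (hu i) hC hC1 hb) hi).trans ?_
  exact (setLIntegral_le_lintegral _ _).trans (lintegral_exp_neg_mul_max_pow_mul_le hβ hδ a hm)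

end Uniform

section Estimator

variable {K : ℝ → ℝ} {n k : ℕ} {h : ℝ}

/-- The coefficient of the maximum over the `r`-th cell in the estimator, which is linear in the
cell maxima. -/
noncomputable def cellWeight (K : ℝ → ℝ) (n k : ℕ) (h x : ℝ) (r : ℕ) : ℝ :=
  1 / (k : ℝ) * (scaledKernel K h (x - cellCenter k r) +
    1 / ((n : ℝ) - k) * ∑ s ∈ Finset.Icc 1 k, scaledKernel K h (x - cellCenter k s))

theorem estimator_eq_sum_cellWeight (K : ℝ → ℝ) (n k : ℕ) (h : ℝ) (S : Set (ℝ × ℝ)) (x : ℝ) :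
    estimator K n k h S x = ∑ r ∈ Finset.Icc 1 k, cellWeight K n k h x r * cellMax S k r := by
  simp only [estimator, cellWeight, mul_add, add_mul, Finset.sum_add_distrib]
  congr 1
  · rw [Finset.mul_sum]
    exact Finset.sum_congr rfl fun r _ => by ring
  · rw [← Finset.sum_mul, ← Finset.mul_sum]
    ring

theorem abs_estimator_sub_le (K : ℝ → ℝ) (n k : ℕ) (h : ℝ) (S T : Set (ℝ × ℝ)) (x : ℝ) :
    |estimator K n k h S x - estimator K n k h T x| ≤
      ∑ r ∈ Finset.Icc 1 k, |cellWeight K n k h x r| * |cellMax S k r - cellMax T k r| := by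
  simp only [estimator_eq_sum_cellWeight, ← Finset.sum_sub_distrib, ← mul_sub, ← abs_mul]
  exact Finset.abs_sum_le_sum_abs _ _

theorem sum_abs_cellWeight_le (hkn : k ≤ n) (K : ℝ → ℝ) (h x : ℝ) :
    ∑ r ∈ Finset.Icc 1 k, |cellWeight K n k h x r| ≤ (1 + k / ((n : ℝ) - k)) *
      (1 / (k : ℝ) * ∑ s ∈ Finset.Icc 1 k, |scaledKernel K h (x - cellCenter k s)|) := by
  have hnk : 0 ≤ 1 / ((n : ℝ) - k) := one_div_nonneg.2 (sub_nonneg.2 (Nat.cast_le.2 hkn))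
  set W := ∑ s ∈ Finset.Icc 1 k, |scaledKernel K h (x - cellCenter k s)| with hW
  have hterm : ∀ r, |cellWeight K n k h x r| ≤
      1 / (k : ℝ) * (|scaledKernel K h (x - cellCenter k r)| + 1 / ((n : ℝ) - k) * W) := by
    intro r
    rw [cellWeight, abs_mul, abs_of_nonneg (by positivity : 0 ≤ 1 / (k : ℝ))]
    refine mul_le_mul_of_nonneg_left ((abs_add_le _ _).trans (add_le_add_right ?_ _))
      (by positivity)
    rw [abs_mul, abs_of_nonneg hnk]
    exact mul_le_mul_of_nonneg_left (Finset.abs_sum_le_sum_abs _ _) hnk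
  refine (Finset.sum_le_sum fun r _ => hterm r).trans_eq ?_
  rw [← Finset.mul_sum, Finset.sum_add_distrib, ← hW, Finset.sum_const, Nat.card_Icc,
    Nat.add_sub_cancel, nsmul_eq_mul]
  ring

theorem card_filter_abs_sub_cellCenter_le (hk : 0 < k) (x : ℝ) {ρ : ℝ} (hρ : 0 ≤ ρ) :
    (((Finset.Icc 1 k).filter fun r => |x - cellCenter k r| ≤ ρ).card : ℝ) ≤ 2 * ρ * k + 1 := by
  have hk0 : (0 : ℝ) < k := Nat.cast_pos.2 hk
  set u : ℝ := k * (x - ρ) + 1 / 2 with hu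
  set w : ℝ := k * (x + ρ) + 1 / 2 with hw
  have hmem : ∀ r ∈ (Finset.Icc 1 k).filter fun r => |x - cellCenter k r| ≤ ρ,
      (r : ℤ) ∈ Finset.Icc ⌈u⌉ ⌊w⌋ := by
    intro r hr
    obtain ⟨hleft, hright⟩ := abs_le.1 (Finset.mem_filter.1 hr).2
    have hcenter : k * cellCenter k r = r - 1 / 2 := by
      rw [cellCenter]
      field_simp
    rw [Finset.mem_Icc, Int.ceil_le, Int.le_floor, Int.cast_natCast]
    constructor <;> nlinarith only [hu, hw, hcenter, mul_le_mul_of_nonneg_left hleft hk0.le,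
      mul_le_mul_of_nonneg_left hright hk0.le]
  have hcard := Finset.card_le_card_of_injOn (fun r : ℕ => (r : ℤ)) hmem Nat.cast_injective.injOn
  calc (((Finset.Icc 1 k).filter fun r => |x - cellCenter k r| ≤ ρ).card : ℝ)
      ≤ ((⌊w⌋ + 1 - ⌈u⌉).toNat : ℝ) := by
        rw [← Int.card_Icc]
        exact_mod_cast hcard
    _ = max ((⌊w⌋ : ℝ) + 1 - ⌈u⌉) 0 := by exact_mod_cast Int.toNat_eq_max _
    _ ≤ 2 * ρ * k + 1 := by
        refine max_le ?_ (by positivity)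
        linarith [Int.floor_le w, Int.le_ceil u]

theorem abs_scaledKernel_le {A B : ℝ} (hA : Function.support K ⊆ Set.Icc (-A) A)
    (hB : ∀ t, |K t| ≤ B) (hh : 0 < h) (t : ℝ) :
    |scaledKernel K h t| ≤ if |t| ≤ |A| * h then B / h else 0 := by
  rw [scaledKernel, abs_mul, abs_of_pos (one_div_pos.2 hh), one_div_mul_eq_div]
  split_ifs with ht
  · gcongr
    exact hB _
  · have hzero : K (t / h) = 0 := by
      by_contra hne
      have hle : |t / h| ≤ |A| := (abs_le.2 (hA hne)).trans (le_abs_self A)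
      rw [abs_div, abs_of_pos hh, div_le_iff₀ hh] at hle
      exact ht hle
    rw [hzero, abs_zero, zero_div]

theorem sum_abs_scaledKernel_le {A B : ℝ} (hA : Function.support K ⊆ Set.Icc (-A) A)
    (hB : ∀ t, |K t| ≤ B) (hk : 0 < k) (hh : 0 < h) (x : ℝ) :
    1 / (k : ℝ) * ∑ r ∈ Finset.Icc 1 k, |scaledKernel K h (x - cellCenter k r)| ≤
      B * (2 * |A| + 1 / (h * k)) := by
  have hB0 : 0 ≤ B := (abs_nonneg _).trans (hB 0)
  calc 1 / (k : ℝ) * ∑ r ∈ Finset.Icc 1 k, |scaledKernel K h (x - cellCenter k r)|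
      ≤ 1 / (k : ℝ) * ∑ r ∈ Finset.Icc 1 k,
          if |x - cellCenter k r| ≤ |A| * h then B / h else 0 := by
        gcongr with r
        exact abs_scaledKernel_le hA hB hh _
    _ ≤ 1 / (k : ℝ) * ((2 * (|A| * h) * k + 1) * (B / h)) := by
        rw [← Finset.sum_filter, Finset.sum_const, nsmul_eq_mul]
        gcongr
        exact card_filter_abs_sub_cellCenter_le hk x (by positivity)
    _ = B * (2 * |A| + 1 / (h * k)) := by field_simp

theorem sum_abs_cellWeight_le_of_le_mul {A B c θ : ℝ} (hA : Function.support K ⊆ Set.Icc (-A) A)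
    (hB : ∀ t, |K t| ≤ B) (hk : 0 < k) (hθ : θ < 1) (hkn : k ≤ θ * n) (hc : 0 < c)
    (hhk : c ≤ h * k) (x : ℝ) :
    ∑ r ∈ Finset.Icc 1 k, |cellWeight K n k h x r| ≤ (1 - θ)⁻¹ * (B * (2 * |A| + 1 / c)) := by
  have hk0 : (0 : ℝ) < k := Nat.cast_pos.2 hk
  have hh : 0 < h := pos_of_mul_pos_left (hc.trans_le hhk) hk0.le
  have hB0 : 0 ≤ B := (abs_nonneg _).trans (hB 0)
  have hn0 : (0 : ℝ) < n := by
    rcases n.eq_zero_or_pos with rfl | hn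
    · exact absurd hkn (by simpa using hk.ne')
    · exact Nat.cast_pos.2 hn
  have hlt : (k : ℝ) < n := hkn.trans_lt (mul_lt_of_lt_one_left hn0 hθ)
  have hθ1 : 0 < 1 - θ := sub_pos.2 hθ
  calc ∑ r ∈ Finset.Icc 1 k, |cellWeight K n k h x r|
      ≤ (1 + k / ((n : ℝ) - k)) *
          (1 / (k : ℝ) * ∑ s ∈ Finset.Icc 1 k, |scaledKernel K h (x - cellCenter k s)|) :=
        sum_abs_cellWeight_le (Nat.cast_le.1 hlt.le) K h x
    _ ≤ (1 - θ)⁻¹ * (B * (2 * |A| + 1 / (h * k))) := by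
        refine mul_le_mul ?_ (sum_abs_scaledKernel_le hA hB hk hh x) (by positivity) (by positivity)
        have hnk : 0 < (n : ℝ) - k := sub_pos.2 hlt
        rw [one_add_div hnk.ne', sub_add_cancel, div_le_iff₀ hnk, inv_mul_eq_div, le_div_iff₀ hθ1]
        linarith
    _ ≤ (1 - θ)⁻¹ * (B * (2 * |A| + 1 / c)) := by gcongr

variable {Ω : Type*} [MeasurableSpace Ω] {P : Measure Ω} {S T : Ω → Set (ℝ × ℝ)}

theorem integrable_estimator (hS : ∀ r, Integrable (fun ω => cellMax (S ω) k r) P) (K : ℝ → ℝ)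
    (n : ℕ) (h x : ℝ) : Integrable (fun ω => estimator K n k h (S ω) x) P := by
  simp only [estimator_eq_sum_cellWeight]
  exact integrable_finsetSum _ fun r _ => (hS r).const_mul _

theorem integral_abs_estimator_sub_le (hS : ∀ r, Integrable (fun ω => cellMax (S ω) k r) P)
    (hT : ∀ r, Integrable (fun ω => cellMax (T ω) k r) P) {b : ℝ}
    (hb : ∀ r ∈ Finset.Icc 1 k, ∫ ω, |cellMax (S ω) k r - cellMax (T ω) k r| ∂P ≤ b)
    (K : ℝ → ℝ) (n : ℕ) (h x : ℝ) :
    ∫ ω, |estimator K n k h (S ω) x - estimator K n k h (T ω) x| ∂P ≤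
      (∑ r ∈ Finset.Icc 1 k, |cellWeight K n k h x r|) * b := by
  have hterm : ∀ r, Integrable (fun ω => |cellWeight K n k h x r| *
      |cellMax (S ω) k r - cellMax (T ω) k r|) P := fun r => ((hS r).sub (hT r)).abs.const_mul _
  calc ∫ ω, |estimator K n k h (S ω) x - estimator K n k h (T ω) x| ∂P
      ≤ ∫ ω, ∑ r ∈ Finset.Icc 1 k, |cellWeight K n k h x r| *
          |cellMax (S ω) k r - cellMax (T ω) k r| ∂P :=
        integral_mono
          ((integrable_estimator hS K n h x).sub (integrable_estimator hT K n h x)).abs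
          (integrable_finsetSum _ fun r _ => hterm r) fun ω => abs_estimator_sub_le ..
    _ = ∑ r ∈ Finset.Icc 1 k, |cellWeight K n k h x r| *
          ∫ ω, |cellMax (S ω) k r - cellMax (T ω) k r| ∂P := by
        rw [integral_finsetSum _ fun r _ => hterm r]
        exact Finset.sum_congr rfl fun r _ => integral_const_mul _ _
    _ ≤ (∑ r ∈ Finset.Icc 1 k, |cellWeight K n k h x r|) * b := by
        rw [Finset.sum_mul]
        gcongr with r hr
        exact hb r hr

end Estimator

section CellMax

variable {Ω : Type*} [MeasurableSpace Ω] {P : Measure Ω} {f : ℝ → ℝ} {F : ℝ≥0}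
  {Z : ℕ → Ω → ℝ × ℝ} {N : Ω → ℕ} {n k r : ℕ}

theorem ae_forall_mem_of_isUniform {s : Set (ℝ × ℝ)} (hs : MeasurableSet s)
    (hZ : ∀ i, Measurable (Z i)) (hu : ∀ i, pdf.IsUniform (Z i) s P volume) :
    ∀ᵐ ω ∂P, ∀ i, Z i ω ∈ s := by
  refine ae_all_iff.2 fun i => ae_of_ae_map (hZ i).aemeasurable ?_
  rw [hu i]
  exact ae_cond_mem hs

theorem integrable_cellMax_firstPoints [IsFiniteMeasure P] (hF : ∀ x ∈ Set.Icc (0 : ℝ) 1, f x ≤ F)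
    (hZ : ∀ i, Measurable (Z i)) (hZf : ∀ᵐ ω ∂P, ∀ i, Z i ω ∈ region f) (hN : Measurable N)
    (k r : ℕ) : Integrable (fun ω => cellMax (firstPoints Z (N ω) ω) k r) P := by
  let U : ℕ → Ω → ℝ≥0 := fun m ω => (Finset.range m).sup fun i => heightOver (cell k r) (Z i ω)
  have hU : Measurable fun p : Ω × ℕ => U p.2 p.1 := measurable_from_prod_countable_left fun m =>
    measurable_sup_range (fun i => (measurable_heightOver (measurableSet_cell k r)).comp (hZ i)) m
  have hUN : Measurable fun ω => (U (N ω) ω : ℝ) :=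
    (hU.comp (measurable_id.prodMk hN)).coe_nnreal_real
  have hbound : ∀ᵐ ω ∂P, ‖(U (N ω) ω : ℝ)‖ ≤ F := by
    filter_upwards [hZf] with ω hω
    rw [NNReal.norm_eq, NNReal.coe_le_coe]
    exact Finset.sup_le fun i _ => heightOver_le_of_mem_region hF (hω i)
  refine (Integrable.of_bound hUN.aestronglyMeasurable F hbound).congr ?_
  filter_upwards [hZf] with ω hω
  exact (cellMax_firstPoints (fun i => (hω i).2.1) _ _ _).symm

theorem lintegral_heightOver_cell_sub_sup_range_le (hZ : ∀ i, Measurable (Z i))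
    (hind : iIndepFun Z P) (hu : ∀ i, pdf.IsUniform (Z i) (region f) P volume) (hn : 0 < n)
    (hr : r ∈ Finset.Icc 1 k) {a b : ℝ} (hb : 0 ≤ b)
    (hf : ∀ x ∈ cell k r, f x ∈ Set.Icc a (a + b * (k / n))) {i : ℕ}
    (hi : ⌈(n : ℝ) / 2⌉₊ ≤ i) :
    ∫⁻ ω, ((heightOver (cell k r) (Z i ω) - (Finset.range ⌈(n : ℝ) / 2⌉₊).sup fun j =>
        heightOver (cell k r) (Z j ω) : ℝ≥0) : ℝ≥0∞) ∂P ≤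
      ENNReal.ofReal ((4 * volume.real (region f) + 2 * b + b ^ 2 / volume.real (region f)) *
        (k / n ^ 2)) := by
  have := hind.isProbabilityMeasure
  have hk : (0 : ℝ) < k := Nat.cast_pos.2 (Finset.nonempty_Icc.1 ⟨r, hr⟩)
  obtain ⟨h0, ht⟩ := volume_ne_zero_and_ne_top_of_isUniform (hZ 0) (hu 0)
  have hV : 0 < volume.real (region f) := ENNReal.toReal_pos h0 ht
  have hcell : volume.real (cell k r) = 1 / k := by
    rw [Measure.real, volume_cell, ENNReal.toReal_ofReal (by positivity)]
  refine (lintegral_heightOver_sub_sup_range_le hZ hind hu (measurableSet_cell k r)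
    (cell_subset_Icc hr) (by rw [volume_cell]; positivity) (by positivity) (fun x hx => (hf x hx).1)
    (fun x hx => (hf x hx).2) (Nat.ceil_pos.2 (by positivity)) hi).trans
    (ENNReal.ofReal_le_ofReal ?_)
  rw [hcell]
  set V := volume.real (region f)
  calc 1 / ((⌈(n : ℝ) / 2⌉₊ : ℝ) ^ 2 * (1 / k / V)) + b * (k / n) / ⌈(n : ℝ) / 2⌉₊ +
        1 / k / V * (b * (k / n)) ^ 2
      ≤ 1 / (((n : ℝ) / 2) ^ 2 * (1 / k / V)) + b * (k / n) / (n / 2) +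
        1 / k / V * (b * (k / n)) ^ 2 := by gcongr <;> exact Nat.le_ceil _
    _ = (4 * V + 2 * b + b ^ 2 / V) * (k / n ^ 2) := by
        field_simp
        ring

theorem integral_abs_cellMax_firstPoints_sub_le [IsProbabilityMeasure P]
    (hF : ∀ x ∈ Set.Icc (0 : ℝ) 1, f x ≤ F) (hZ : ∀ i, Measurable (Z i))
    (hZf : ∀ᵐ ω ∂P, ∀ i, Z i ω ∈ region f) (hN : Measurable N)
    (hNZ : IndepFun N (fun ω i => Z i ω) P) {σ : ℝ≥0} (hn : 0 < n)
    (hσ : eLpNorm (fun ω => (N ω : ℝ) - n) 2 P ≤ ENNReal.ofReal (σ * √n)) {ε : ℝ} (hε0 : 0 ≤ ε)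
    (hε : ∀ i, ⌈(n : ℝ) / 2⌉₊ ≤ i →
      ∫⁻ ω, ((heightOver (cell k r) (Z i ω) - (Finset.range ⌈(n : ℝ) / 2⌉₊).sup fun j =>
        heightOver (cell k r) (Z j ω) : ℝ≥0) : ℝ≥0∞) ∂P ≤ ENNReal.ofReal ε) :
    ∫ ω, |cellMax (firstPoints Z n ω) k r - cellMax (firstPoints Z (N ω) ω) k r| ∂P ≤
      σ * √n * ε + 4 * σ ^ 2 * F / n := by
  have hv : Measurable (heightOver (cell k r)) := measurable_heightOver (measurableSet_cell k r)
  have hhalf : ⌈(n : ℝ) / 2⌉₊ ≤ n :=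
    Nat.ceil_le.2 (half_le_self (Nat.cast_nonneg n))
  have hmean : eLpNorm (fun ω => (N ω : ℝ) - n) 1 P ≤ ENNReal.ofReal (σ * √n) :=
    (eLpNorm_le_eLpNorm_of_exponent_le one_le_two (by fun_prop)).trans hσ
  refine (integral_norm_eq_lintegral_enorm ((integrable_cellMax_firstPoints hF hZ hZf
    measurable_const k r).sub (integrable_cellMax_firstPoints hF hZ hZf hN k r)).1).trans_le
    (ENNReal.toReal_le_of_le_ofReal (by positivity) ?_)
  calc ∫⁻ ω, ‖cellMax (firstPoints Z n ω) k r - cellMax (firstPoints Z (N ω) ω) k r‖ₑ ∂P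
      = ∫⁻ ω, edist ((Finset.range n).sup fun i => heightOver (cell k r) (Z i ω))
          ((Finset.range (N ω)).sup fun i => heightOver (cell k r) (Z i ω)) ∂P :=
        lintegral_congr_ae (hZf.mono fun ω hω =>
          enorm_cellMax_firstPoints_sub (fun i => (hω i).2.1) n (N ω) k r)
    _ ≤ ENNReal.ofReal (σ * √n) * ENNReal.ofReal ε + ENNReal.ofReal (4 * σ ^ 2 / n) * F := by
        refine (lintegral_edist_sup_range_random_le (fun i => hv.comp (hZ i))
          (hZf.mono fun ω hω i => heightOver_le_of_mem_region hF (hω i)) hN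
          (hNZ.comp measurable_id (measurable_pi_lambda _ fun i => hv.comp (measurable_pi_apply i)))
          hhalf hε).trans ?_
        gcongr
        exact measure_lt_ceil_half_le_of_eLpNorm_le hN hn hσ
    _ = ENNReal.ofReal (σ * √n * ε + 4 * σ ^ 2 * F / n) := by
        rw [← ENNReal.ofReal_mul (by positivity), ← ENNReal.ofReal_coe_nnreal,
          ← ENNReal.ofReal_mul (by positivity),
          ← ENNReal.ofReal_add (by positivity) (by positivity), div_mul_eq_mul_div]

theorem abs_sub_apply_cellCenter_le {α L : ℝ≥0} (hf : HolderOnWith L α f (Set.Icc 0 1))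
    (hr : r ∈ Finset.Icc 1 k) (hn : 0 < n) {c : ℝ} (hnk : n ≤ c * (k : ℝ) ^ (1 + (α : ℝ))) {x : ℝ}
    (hx : x ∈ cell k r) : |f x - f (cellCenter k r)| ≤ L * c * (k / n) := by
  have hk : 0 < k := Finset.nonempty_Icc.1 ⟨r, hr⟩
  have hk0 : (0 : ℝ) < k := Nat.cast_pos.2 hk
  have hn0 : (0 : ℝ) < n := Nat.cast_pos.2 hn
  have hcenter := cellCenter_mem_cell hk r
  have hrpow : (1 / (k : ℝ)) ^ (α : ℝ) ≤ c * (k / n) := by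
    rw [Real.rpow_add hk0, Real.rpow_one] at hnk
    rw [one_div, Real.inv_rpow hk0.le, inv_eq_one_div, mul_div_assoc',
      div_le_div_iff₀ (by positivity) hn0]
    linarith
  calc |f x - f (cellCenter k r)|
      ≤ L * (1 / (k : ℝ)) ^ (α : ℝ) := by
        rw [← Real.dist_eq]
        exact hf.dist_le_of_le (cell_subset_Icc hr hx) (cell_subset_Icc hr hcenter)
          (abs_sub_le_of_mem_cell hx hcenter)
    _ ≤ L * c * (k / n) := by
        rw [mul_assoc]
        gcongr

end CellMax

section Rate

variable {Ω : Type*} [MeasurableSpace Ω] {P : Measure Ω} {f : ℝ → ℝ}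
  {α L F σ : ℝ≥0} {Z : ℕ → Ω → ℝ × ℝ} {c : ℝ}

theorem sqrt_mul_div_sq_le {x y : ℝ} (hx : 0 ≤ x) (hxy : x ≤ y) : √y * (x / y ^ 2) ≤ √x / y := by
  calc √y * (x / y ^ 2) = √y * √x * (√x / y ^ 2) := by
        rw [mul_assoc, ← mul_div_assoc √x, Real.mul_self_sqrt hx]
    _ ≤ √y * √y * (√x / y ^ 2) := by gcongr
    _ = √x / y := by
        rw [Real.mul_self_sqrt (hx.trans hxy)]
        field_simp

theorem integral_abs_cellMax_firstPoints_sub_le_of_holderOnWith (hα : 0 < α)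
    (hf : HolderOnWith L α f (Set.Icc 0 1)) (hF : ∀ x ∈ Set.Icc (0 : ℝ) 1, f x ≤ F)
    (hZ : ∀ i, Measurable (Z i)) (hind : iIndepFun Z P)
    (hu : ∀ i, pdf.IsUniform (Z i) (region f) P volume) {N : Ω → ℕ} (hN : Measurable N)
    (hNZ : IndepFun N (fun ω i => Z i ω) P) {n k r : ℕ} (hn : 0 < n)
    (hσ : eLpNorm (fun ω => (N ω : ℝ) - n) 2 P ≤ ENNReal.ofReal (σ * √n)) (hkn : k ≤ n)
    (hc : 0 ≤ c) (hnk : n ≤ c * (k : ℝ) ^ (1 + (α : ℝ))) (hr : r ∈ Finset.Icc 1 k) :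
    ∫ ω, |cellMax (firstPoints Z n ω) k r - cellMax (firstPoints Z (N ω) ω) k r| ∂P ≤
      (σ * (4 * volume.real (region f) + 4 * L * c + (2 * L * c) ^ 2 / volume.real (region f)) +
        4 * σ ^ 2 * F) * (√k / n) := by
  have := hind.isProbabilityMeasure
  have hk : 1 ≤ k := Finset.nonempty_Icc.1 ⟨r, hr⟩
  set V := volume.real (region f)
  have hosc : ∀ x ∈ cell k r, f x ∈ Set.Icc (f (cellCenter k r) - L * c * (k / n))
      (f (cellCenter k r) - L * c * (k / n) + 2 * L * c * (k / n)) := by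
    intro x hx
    obtain ⟨hlower, hupper⟩ := abs_le.1 (abs_sub_apply_cellCenter_le hf hr hn hnk hx)
    constructor <;> linarith
  refine (integral_abs_cellMax_firstPoints_sub_le hF hZ
    (ae_forall_mem_of_isUniform (measurableSet_region (hf.continuousOn hα)) hZ hu) hN hNZ hn hσ
    (by positivity) fun i hi =>
      lintegral_heightOver_cell_sub_sup_range_le hZ hind hu hn hr (by positivity) hosc hi).trans ?_
  have hsqrt : √n * (k / n ^ 2) ≤ √k / n :=
    sqrt_mul_div_sq_le (Nat.cast_nonneg k) (Nat.cast_le.2 hkn)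
  have hone : 1 / (n : ℝ) ≤ √k / n := by
    gcongr
    exact Real.one_le_sqrt.2 (Nat.one_le_cast.2 hk)
  calc σ * √n * ((4 * V + 2 * (2 * L * c) + (2 * L * c) ^ 2 / V) * (k / n ^ 2)) +
        4 * σ ^ 2 * F / n
      = σ * (4 * V + 4 * L * c + (2 * L * c) ^ 2 / V) * (√n * (k / n ^ 2)) +
          4 * σ ^ 2 * F * (1 / n) := by ring
    _ ≤ σ * (4 * V + 4 * L * c + (2 * L * c) ^ 2 / V) * (√k / n) +
          4 * σ ^ 2 * F * (√k / n) := by gcongr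
    _ = (σ * (4 * V + 4 * L * c + (2 * L * c) ^ 2 / V) + 4 * σ ^ 2 * F) * (√k / n) := by ring

theorem integral_abs_estimator_firstPoints_sub_le (hα : 0 < α)
    (hf : HolderOnWith L α f (Set.Icc 0 1)) (hF : ∀ x ∈ Set.Icc (0 : ℝ) 1, f x ≤ F) {K : ℝ → ℝ}
    {A B : ℝ} (hA : Function.support K ⊆ Set.Icc (-A) A) (hB : ∀ t, |K t| ≤ B)
    (hZ : ∀ i, Measurable (Z i)) (hind : iIndepFun Z P)
    (hu : ∀ i, pdf.IsUniform (Z i) (region f) P volume) {N : Ω → ℕ} (hN : Measurable N)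
    (hNZ : IndepFun N (fun ω i => Z i ω) P) {n k : ℕ} (hn : 0 < n)
    (hσ : eLpNorm (fun ω => (N ω : ℝ) - n) 2 P ≤ ENNReal.ofReal (σ * √n)) {θ : ℝ} (hθ : θ < 1)
    (hkn : k ≤ θ * n) (hc : 0 ≤ c) (hnk : n ≤ c * (k : ℝ) ^ (1 + (α : ℝ))) {b h : ℝ} (hb : 0 < b)
    (hhk : b ≤ h * k) (x : ℝ) :
    ∫ ω, |estimator K n k h (firstPoints Z n ω) x -
        estimator K n k h (firstPoints Z (N ω) ω) x| ∂P ≤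
      (1 - θ)⁻¹ * (B * (2 * |A| + 1 / b)) * ((σ * (4 * volume.real (region f) + 4 * L * c +
        (2 * L * c) ^ 2 / volume.real (region f)) + 4 * σ ^ 2 * F) * (√k / n)) := by
  have := hind.isProbabilityMeasure
  have hk : 0 < k := by
    rcases k.eq_zero_or_pos with rfl | hk
    · exact absurd hhk (by simpa using hb)
    · exact hk
  have hkn' : k ≤ n :=
    Nat.cast_le.1 (hkn.trans (mul_le_of_le_one_left (Nat.cast_nonneg n) hθ.le))
  have hint : ∀ {M : Ω → ℕ}, Measurable M → ∀ r,
      Integrable (fun ω => cellMax (firstPoints Z (M ω) ω) k r) P := fun hM r =>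
    integrable_cellMax_firstPoints hF hZ
      (ae_forall_mem_of_isUniform (measurableSet_region (hf.continuousOn hα)) hZ hu) hM k r
  refine (integral_abs_estimator_sub_le (hint measurable_const) (hint hN)
    (fun r hr => integral_abs_cellMax_firstPoints_sub_le_of_holderOnWith hα hf hF hZ hind hu hN
      hNZ hn hσ hkn' hc hnk hr) K n h x).trans ?_
  gcongr
  exact sum_abs_cellWeight_le_of_le_mul hA hB hk hθ hkn hb hhk x

end Rate

theorem eventually_le_half_of_isLittleO_div_log {k : ℕ → ℕ}
    (hk : (fun n : ℕ => (k n : ℝ)) =o[atTop] fun n : ℕ => (n : ℝ) / Real.log n) :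
    ∀ᶠ n : ℕ in atTop, (k n : ℝ) ≤ 1 / 2 * n := by
  have hlog : ∀ᶠ n : ℕ in atTop, 1 ≤ Real.log n :=
    (Real.tendsto_log_atTop.comp tendsto_natCast_atTop_atTop).eventually_ge_atTop 1
  filter_upwards [hk.bound one_half_pos, hlog] with n hkn hn
  rw [Real.norm_of_nonneg (Nat.cast_nonneg _), Real.norm_of_nonneg (by positivity)] at hkn
  exact hkn.trans (mul_le_mul_of_nonneg_left (div_le_self (Nat.cast_nonneg n) hn) (by norm_num))

end BoundaryEstimation

open BoundaryEstimation in
theorem proposition1_general {Ω : Type*} [MeasurableSpace Ω] {P : Measure Ω}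
    {f : ℝ → ℝ} {α L : ℝ≥0} (hα : 0 < α) (hf : HolderOnWith L α f (Set.Icc 0 1))
    {K : ℝ → ℝ} {A B : ℝ} (hA : Function.support K ⊆ Set.Icc (-A) A) (hB : ∀ t, |K t| ≤ B)
    {k : ℕ → ℕ} {θ : ℝ} (hθ : θ < 1) (hk : ∀ᶠ n : ℕ in atTop, (k n : ℝ) ≤ θ * n)
    {h : ℕ → ℝ} (hh : Tendsto h atTop (𝓝 0)) {b : ℝ} (hb : 0 < b)
    (hhk : ∀ᶠ n in atTop, b ≤ h n * k n)
    (hkα : (fun n : ℕ => (n : ℝ)) =O[atTop] fun n : ℕ => (k n : ℝ) ^ (1 + (α : ℝ)))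
    {Z : ℕ → Ω → ℝ × ℝ} (hZ : ∀ i, Measurable (Z i)) (hind : iIndepFun Z P)
    (hu : ∀ i, pdf.IsUniform (Z i) (region f) P volume) {N : ℕ → Ω → ℕ}
    (hN : ∀ n, Measurable (N n)) (hNZ : ∀ n, IndepFun (N n) (fun ω i => Z i ω) P) {σ : ℝ≥0}
    (hσ : ∀ n, eLpNorm (fun ω => (N n ω : ℝ) - n) 2 P ≤ ENNReal.ofReal (σ * √n)) (x : ℝ) :
    (∀ n, Integrable (fun ω => estimator K n (k n) (h n) (firstPoints Z n ω) x -
        estimator K n (k n) (h n) (firstPoints Z (N n ω) ω) x) P) ∧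
      Tendsto (fun n : ℕ => (n : ℝ) * √(h n) / √(k n : ℝ) *
          ∫ ω, |estimator K n (k n) (h n) (firstPoints Z n ω) x -
            estimator K n (k n) (h n) (firstPoints Z (N n ω) ω) x| ∂P)
        atTop (𝓝 0) := by
  have := hind.isProbabilityMeasure
  obtain ⟨F, hF⟩ : ∃ F : ℝ≥0, ∀ y ∈ Set.Icc (0 : ℝ) 1, f y ≤ F := by
    obtain ⟨F, hF⟩ := isCompact_Icc.exists_bound_of_continuousOn (hf.continuousOn hα)
    exact ⟨F.toNNReal, fun y hy => (le_abs_self _).trans ((hF y hy).trans F.le_coe_toNNReal)⟩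
  constructor
  · have hZf := ae_forall_mem_of_isUniform (measurableSet_region (hf.continuousOn hα)) hZ hu
    have hint : ∀ n {M : Ω → ℕ}, Measurable M →
        Integrable (fun ω => estimator K n (k n) (h n) (firstPoints Z (M ω) ω) x) P := fun n _ hM =>
      integrable_estimator (integrable_cellMax_firstPoints hF hZ hZf hM (k n)) K n (h n) x
    exact fun n => (hint n measurable_const).sub (hint n (hN n))
  obtain ⟨c, hc, hkc⟩ := hkα.exists_nonneg
  set R := (1 - θ)⁻¹ * (B * (2 * |A| + 1 / b)) * (σ * (4 * volume.real (region f) + 4 * L * c +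
    (2 * L * c) ^ 2 / volume.real (region f)) + 4 * σ ^ 2 * F)
  have hlim : Tendsto (fun n => R * √(h n)) atTop (𝓝 0) := by
    simpa using hh.sqrt.const_mul R
  refine squeeze_zero' (.of_forall fun n => by positivity) ?_ hlim
  filter_upwards [hk, hhk, hkc.bound, eventually_gt_atTop 0] with n hkn hhkn hnk hn
  rw [Real.norm_of_nonneg (by positivity), Real.norm_of_nonneg (by positivity)] at hnk
  have hk0 : (k n : ℝ) ≠ 0 := right_ne_zero_of_mul (hb.trans_le hhkn).ne'
  calc _ ≤ n * √(h n) / √(k n : ℝ) * (R * (√(k n : ℝ) / n)) := by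
        gcongr
        exact (integral_abs_estimator_firstPoints_sub_le hα hf hF hA hB hZ hind hu (hN n) (hNZ n)
          hn (hσ n) hθ hkn hc hnk hb hhkn x).trans_eq (mul_assoc ..).symm
    _ = R * √(h n) := by field_simp

theorem proposition1
    {Ω : Type*} [MeasurableSpace Ω] (P : Measure Ω) [IsProbabilityMeasure P]
    -- the boundary function: positive and `α`-Lipschitzian (Hölder of exponent `α`) on `[0, 1]`
    (f : ℝ → ℝ) (α L : ℝ≥0) (hα0 : 0 < α) (hα1 : α ≤ 1)
    (hf_pos : ∀ x ∈ Set.Icc (0 : ℝ) 1, 0 < f x)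
    (hf : HolderOnWith L α f (Set.Icc (0 : ℝ) 1))
    (K : ℝ → ℝ) (hK : BoundaryEstimation.IsKernel K)
    -- the numbers of cells and the bandwidths
    (k : ℕ → ℕ) (hk_mono : Monotone k) (hk_top : Tendsto k atTop atTop)
    (hk : ∀ᶠ n in atTop, 0 < k n ∧ k n < n)
    (h : ℕ → ℝ) (hh_pos : ∀ n, 0 < h n) (hh_anti : Antitone h) (hh_zero : Tendsto h atTop (𝓝 0))
    -- the sample: independent points, uniformly distributed on the region below the graph of `f`
    (Z : ℕ → Ω → ℝ × ℝ) (hZ_meas : ∀ i, Measurable (Z i)) (hZ_indep : iIndepFun Z P)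
    (hZ_unif : ∀ i, pdf.IsUniform (Z i) (BoundaryEstimation.region f) P volume)
    -- the number of points of the Poisson process: a Poisson variable of mean `n`,
    -- independent of the whole sequence `Z`
    (N : ℕ → Ω → ℕ) (hN_meas : ∀ n, Measurable (N n))
    (hN_law : ∀ n, HasLaw (N n) (poissonMeasure (n : ℝ≥0)) P)
    (hN_indep : ∀ n, IndepFun (N n) (fun ω i => Z i ω) P)
    -- the growth conditions
    (hk_small : (fun n : ℕ => (k n : ℝ)) =o[atTop] fun n : ℕ => (n : ℝ) / Real.log n)
    (hhk : Tendsto (fun n => h n * k n) atTop atTop)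
    (hk_large : (fun n : ℕ => (n : ℝ)) =O[atTop] fun n : ℕ => (k n : ℝ) ^ (1 + (α : ℝ)))
    (x : ℝ) (hx : x ∈ Set.Ioo (0 : ℝ) 1) :
    (∀ n, Integrable (fun ω =>
        BoundaryEstimation.estimator K n (k n) (h n)
            (BoundaryEstimation.firstPoints Z n ω) x -
          BoundaryEstimation.estimator K n (k n) (h n)
            (BoundaryEstimation.firstPoints Z (N n ω) ω) x) P) ∧
    Tendsto (fun n : ℕ => (n : ℝ) * √(h n) / √(k n : ℝ) *
        ∫ ω, |BoundaryEstimation.estimator K n (k n) (h n)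
            (BoundaryEstimation.firstPoints Z n ω) x -
          BoundaryEstimation.estimator K n (k n) (h n)
            (BoundaryEstimation.firstPoints Z (N n ω) ω) x| ∂P)
      atTop (𝓝 0) := by
  obtain ⟨A, hA⟩ := hK.support_subset
  obtain ⟨B, hB⟩ := hK.bounded
  exact proposition1_general hα0 hf hA (fun t => (abs_of_nonneg (hK.nonneg t)).trans_le (hB t))
    one_half_lt_one (BoundaryEstimation.eventually_le_half_of_isLittleO_div_log hk_small) hh_zero
    one_pos (hhk.eventually_ge_atTop 1) hk_large hZ_meas hZ_indep hZ_unif hN_meas hN_indep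
    (σ := 1) (fun n => by
      simpa using (BoundaryEstimation.eLpNorm_natCast_sub_of_hasLaw_poissonMeasure (hN_law n)).le) x
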